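/- \textbf{Theorem.} Let $p\ge 1$ and $n_1\ge 1$ be integers, and put $n_0=0$, $n_k=n_1+(k-1)p$ for $k\ge1$. Let $\mathcal X$ and $\Theta$ be compact metric spaces, let $\mu:\mathcal X\times\Theta\to\mathbb R$ and $(x,\theta)\mapsto f_\theta(x)\in\mathbb R^p$ be continuous on $\mathcal X\times\Theta$, and suppose that for each $\theta\in\Theta$ the image $f_\theta(\mathcal X)$ spans $\mathbb R^p$. Let $\overline\theta\in\Theta$, and let $X_i$ ($\mathcal X$-valued, with the Borel $\sigma$-field on $\mathcal X$) and $Y_i$ (real-valued), $i\ge1$, be random variables on a probability space $(\Omega,\mathcal F,\mathbb P)$ satisfying the following. \begin{itemize} \item[(a1)] There are $\sigma$-fields $\mathcal F_0\subseteq\mathcal F_1\subseteq\cdots\subseteq\mathcal F$ such that for each $k\ge1$ the batch $(X_{n_{k-1}+1},\dots,X_{n_k})$ is $\mathcal F_{k-1}$-measurable and the batch $(Y_{n_{k-1}+1},\dots,Y_{n_k})$ is $\mathcal F_k$-measurable. \item[(a2)] $Y_i=\mu(X_i,\overline\theta)+e_i$ for all $i\ge1$, with real-valued square integrable errors $e_i$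 such that the vectors $\mathbf e_k=(e_{n_{k-1}+1},\dots,e_{n_k})^{\mathsf T}$ satisfy $\mathrm E(\mathbf e_k\mid\mathcal F_{k-1})=0$ a.s. for all $k\ge1$, and $\sup_{k\ge1}\mathrm E(\|\mathbf e_k\|^2\mid\mathcal F_{k-1})<\infty$ a.s. \end{itemize} Suppose that the paths are generated by the \emph{$p$-step-ahead algorithm} with some estimators $\widehat\theta_k:(\mathcal X\times\mathbb R)^{n_k}\to\Theta$, $k\ge1$, which may be arbitrary: the first $n_1$ design points are arbitrary, and almost surely, for every $k\ge1$, with $\theta_k=\widehat\theta_k(X_1,Y_1,\dots,X_{n_k},Y_{n_k})$, $$\bigl(\det[f_{\theta_k}(X_{n_k+1}),\dots,f_{\theta_k}(X_{n_k+p})]\bigr)^2=\max_{z_1,\dots,z_p\in\mathcal X}\bigl(\det[f_{\theta_k}(z_1),\dots,f_{\theta_k}(z_p)]\bigr)^2 .$$ Assume that at least one of the following two conditions holds. \begin{itemize} \item[(SI)] For all pairwise distinct $x_1,\dots,x_p\in\mathcal X$ the map $\theta\mapsto(\mu(x_1,\theta),\dots,\mu(x_p,\theta))^{\mathsf T}$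 is injective on $\Theta$. \item[(GLM$^*$)] $\Theta\subseteq\mathbb R^p$, with a metric that induces the subspace topology of $\mathbb R^p$, and there are continuous functions $\psi:\mathcal X\times\Theta\to(0,\infty)$ and $f:\mathcal X\to\mathbb R^p$ with $f_\theta(x)=\psi(x,\theta)f(x)$ for all $(x,\theta)$; moreover there are an open interval $I\subseteq\mathbb R$ and a continuously differentiable $G:I\to\mathbb R$ with $G'>0$ such that $f^{\mathsf T}(x)\theta\in I$ and $\mu(x,\theta)=G(f^{\mathsf T}(x)\theta)$ for all $(x,\theta)\in\mathcal X\times\Theta$. \end{itemize} Let $\widehat\theta_k^{(\mathrm{LS})}:(\mathcal X\times\mathbb R)^{n_k}\to\Theta$, $k\ge1$, be least squares estimators, that is, $\widehat\theta_k^{(\mathrm{LS})}(x_1,y_1,\dots,x_{n_k},y_{n_k})$ minimizes $\sum_{i=1}^{n_k}(y_i-\mu(x_i,\theta))^2$ over $\theta\in\Theta$. Then, almost surely, $$\widehat\theta_k^{(\mathrm{LS})}(X_1,Y_1,\dots,X_{n_k},Y_{n_k})\longrightarrow\overline\theta\qquad(k\to\infty).$$ -/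

import Mathlib

open MeasureTheory ProbabilityTheory Filter Topology

namespace PStepAhead

/-- The sample sizes `n 0 = 0` and `n k = n₁ + (k - 1) * p` for `k ≥ 1`. Observations are indexed
from `0`, so that the first `n k` observations are those with index `i < n k`. -/
def sampleSize (n₁ p : ℕ) : ℕ → ℕ
  | 0 => 0
  | k + 1 => n₁ + k * p

/-- A sequence of parameter estimators: for each `k`, a map from the data
`(x_1, y_1), …, (x_{n k}, y_{n k})` to the parameter space. (The entry `k = 0`, a map of
empty data, is never used.) -/
abbrev EstimatorSeq (n₁ p : ℕ) (𝒳 Θ : Type*) : Type _ :=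
  (k : ℕ) → (Fin (sampleSize n₁ p k) → 𝒳 × ℝ) → Θ

/-- The data available after `k` batches, along a path `x`, `y`. -/
def dataUpTo {𝒳 : Type*} (n₁ p : ℕ) (x : ℕ → 𝒳) (y : ℕ → ℝ) (k : ℕ) :
    Fin (sampleSize n₁ p k) → 𝒳 × ℝ :=
  fun i => (x i, y i)

/-- Conditions on the mean response `μ(x, θ)` and the family `f_θ` (compactness of the
experimental region and of the parameter space is expressed by type classes): joint continuity of
both, and `f_θ(𝒳)` spans `ℝ^p` for every `θ`. -/
structure BasicConditions {𝒳 Θ : Type*} [TopologicalSpace 𝒳] [TopologicalSpace Θ] {p : ℕ}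
    (μ : 𝒳 → Θ → ℝ) (f : Θ → 𝒳 → EuclideanSpace ℝ (Fin p)) : Prop where
  continuous_mean : Continuous (fun q : 𝒳 × Θ => μ q.1 q.2)
  span_eq_top : ∀ θ, Submodule.span ℝ (Set.range (f θ)) = ⊤
  continuous_family : Continuous (fun q : 𝒳 × Θ => f q.2 q.1)

/-- Condition (SI), saturated identifiability. -/
def SI {𝒳 Θ : Type*} (p : ℕ) (μ : 𝒳 → Θ → ℝ) : Prop :=
  ∀ x : Fin p → 𝒳, Function.Injective x →
    Function.Injective (fun (θ : Θ) (j : Fin p) => μ (x j) θ)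

/-- Condition (GLM) with the given functions `ψ` and `f₀`. -/
structure GLM {𝒳 Θ : Type*} [TopologicalSpace 𝒳] [TopologicalSpace Θ] {p : ℕ}
    (f : Θ → 𝒳 → EuclideanSpace ℝ (Fin p))
    (ψ : 𝒳 → Θ → ℝ) (f₀ : 𝒳 → EuclideanSpace ℝ (Fin p)) : Prop where
  continuous_psi : Continuous (fun q : 𝒳 × Θ => ψ q.1 q.2)
  psi_pos : ∀ x θ, 0 < ψ x θ
  continuous_base : Continuous f₀
  family_eq : ∀ x θ, f θ x = ψ x θ • f₀ x

/-- Condition (GLM*). That `Θ` is a subset of `ℝ^p` is expressed by a topological embedding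
`ι` of `Θ` in `ℝ^p` (the inclusion); `I` is an open interval, bounded or not. -/
def GLMStar {𝒳 Θ : Type*} [TopologicalSpace 𝒳] [TopologicalSpace Θ] {p : ℕ}
    (μ : 𝒳 → Θ → ℝ) (f : Θ → 𝒳 → EuclideanSpace ℝ (Fin p)) : Prop :=
  ∃ (ψ : 𝒳 → Θ → ℝ) (f₀ : 𝒳 → EuclideanSpace ℝ (Fin p))
    (ι : Θ → EuclideanSpace ℝ (Fin p)) (I : Set ℝ) (G : ℝ → ℝ),
    GLM f ψ f₀ ∧
    IsEmbedding ι ∧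
    IsOpen I ∧ I.OrdConnected ∧
    ContDiffOn ℝ 1 G I ∧ (∀ u ∈ I, 0 < deriv G u) ∧
    (∀ x θ, inner ℝ (f₀ x) (ι θ) ∈ I) ∧
    (∀ x θ, μ x θ = G (inner ℝ (f₀ x) (ι θ)))

/-- The saturated D-criterion `(det [f_θ(z_1), …, f_θ(z_p)])²`. -/
noncomputable def saturatedCriterion {𝒳 Θ : Type*} {p : ℕ}
    (f : Θ → 𝒳 → EuclideanSpace ℝ (Fin p)) (θ : Θ) (z : Fin p → 𝒳) : ℝ :=
  (Matrix.of (fun i j : Fin p => f θ (z j) i)).det ^ 2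

/-- The path `x`, `y` of design points and responses is generated by the `p`-step-ahead algorithm
that employs the estimators `est`: for every `k ≥ 1` the next batch of `p` design points maximizes
the saturated D-criterion at the current estimate. The first `n₁` points are arbitrary. -/
def IsAlgorithmPath {𝒳 Θ : Type*} {p : ℕ} (n₁ : ℕ)
    (f : Θ → 𝒳 → EuclideanSpace ℝ (Fin p)) (est : EstimatorSeq n₁ p 𝒳 Θ)
    (x : ℕ → 𝒳) (y : ℕ → ℝ) : Prop :=
  ∀ k, 1 ≤ k → ∀ z : Fin p → 𝒳,
    saturatedCriterion f (est k (dataUpTo n₁ p x y k)) z ≤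
      saturatedCriterion f (est k (dataUpTo n₁ p x y k))
        (fun j : Fin p => x (sampleSize n₁ p k + j))

/-- The adaptive regression model (a1), (a2) with true parameter point `θbar`, errors `e` and
filtration `ℱ`. The `(k + 1)`-st batch, `k ≥ 0`, consists of the indices `i` with
`n k ≤ i < n (k + 1)`. Measurability and conditional means of the batch vectors are written
coordinatewise; the sum in the last field is the squared Euclidean norm of a batch of errors. -/
structure AdaptiveRegressionModel {Ω 𝒳 Θ : Type*} {mΩ : MeasurableSpace Ω} [MeasurableSpace 𝒳]
    (P : Measure Ω) (n₁ p : ℕ) (μ : 𝒳 → Θ → ℝ) (θbar : Θ) (ℱ : Filtration ℕ mΩ)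
    (X : ℕ → Ω → 𝒳) (Y e : ℕ → Ω → ℝ) : Prop where
  measurable_X : ∀ k i, sampleSize n₁ p k ≤ i → i < sampleSize n₁ p (k + 1) →
    Measurable[ℱ k] (X i)
  measurable_Y : ∀ k i, sampleSize n₁ p k ≤ i → i < sampleSize n₁ p (k + 1) →
    Measurable[ℱ (k + 1)] (Y i)
  response_eq : ∀ i ω, Y i ω = μ (X i ω) θbar + e i ω
  memLp_error : ∀ i, MemLp (e i) 2 P
  condExp_error : ∀ k i, sampleSize n₁ p k ≤ i → i < sampleSize n₁ p (k + 1) →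
    P[e i | ℱ k] =ᵐ[P] 0
  bddAbove_condExp_sq : ∀ᵐ ω ∂P, BddAbove (Set.range fun k : ℕ =>
    (P[fun ω' => ∑ i ∈ Finset.Ico (sampleSize n₁ p k) (sampleSize n₁ p (k + 1)),
      e i ω' ^ 2 | ℱ k]) ω)

/-- `est` is a sequence of least squares estimators: each value minimizes the residual sum of
squares over the parameter space. -/
def IsLeastSquares {𝒳 Θ : Type*} {n₁ p : ℕ} (μ : 𝒳 → Θ → ℝ)
    (est : EstimatorSeq n₁ p 𝒳 Θ) : Prop :=
  ∀ k (d : Fin (sampleSize n₁ p k) → 𝒳 × ℝ) (θ : Θ),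
    ∑ i, ((d i).2 - μ (d i).1 (est k d)) ^ 2 ≤ ∑ i, ((d i).2 - μ (d i).1 θ) ^ 2

end PStepAhead

/-!
Each batch chosen by the algorithm is a saturated design that is D-optimal at some parameter, hence
nonsingular there, because `f_θ(𝒳)` spans `ℝ^p`. In particular its `p` points are pairwise
distinct, as (SI) requires; under (GLM*) the vectors `f₀(z_j)` are linearly independent and `G` is
injective on `I`. So the mean responses at the batch determine the parameter. The pairs
(parameter, design optimal for it) form a compact set, so the sum of `(μ(z_j, θ) - μ(z_j, θbar))²` over a batch is at least
some `c > 0`, uniformly over such batches and over all `θ` with `dist θ θbar ≥ ε`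
(`exists_pos_le_sum_sq_sub`). Nothing about the estimators that drive the algorithm is used.

On the other side, the least squares property gives
`∑ (μ(X_i, θ_k) - μ(X_i, θbar))² ≤ 2 ∑ (μ(X_i, θ_k) - μ(X_i, θbar)) e_i`
for the least squares estimate `θ_k`, so it suffices that the right-hand side is `o(k)` uniformly in
the parameter. For a fixed parameter this is a strong law for martingale differences with almost
surely bounded conditional variances (`tendsto_average_martingaleDiff`), proved by truncation on
predictable events, `L²` martingale convergence and Kronecker's lemma. Uniformity follows from
equicontinuity of `θ ↦ μ(x, θ)` and a finite net, once `∑ |e_i| = O(k)` is known; that bound is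
again an instance of the strong law (`AdaptiveRegressionModel.exists_sum_abs_error_le`).
-/

namespace PStepAhead

/-! ### A strong law of large numbers for martingale differences -/

/-- A special case of Kronecker's lemma, by summation by parts and Cesàro averaging. -/
theorem tendsto_sum_div_of_tendsto_sum_div_succ {a : ℕ → ℝ} {c : ℝ}
    (h : Tendsto (fun n => ∑ k ∈ Finset.range n, a k / (k + 1)) atTop (𝓝 c)) :
    Tendsto (fun n : ℕ => (∑ k ∈ Finset.range n, a k) / n) atTop (𝓝 0) := by
  set S : ℕ → ℝ := fun n => ∑ k ∈ Finset.range n, a k / (k + 1) with hS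
  have key : ∀ n : ℕ, ∑ k ∈ Finset.range n, a k = n * S n - ∑ k ∈ Finset.range n, S k := by
    intro n
    induction n with
    | zero => simp
    | succ n ih =>
      have hn : (n : ℝ) + 1 ≠ 0 := by positivity
      have hSn : S (n + 1) = S n + a n / (n + 1) := by simp [hS, Finset.sum_range_succ]
      rw [Finset.sum_range_succ, ih, Finset.sum_range_succ, hSn]
      push_cast
      field_simp
      ring
  have h2 := h.sub h.cesaro
  rw [sub_self] at h2
  refine h2.congr' ?_
  filter_upwards [eventually_ne_atTop 0] with n hn
  have hn' : (n : ℝ) ≠ 0 := by exact_mod_cast hn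
  rw [key n]
  field_simp

section MartingaleDifferences

variable {Ω : Type*} {mΩ : MeasurableSpace Ω} {P : Measure Ω} [IsProbabilityMeasure P]
  {ℱ : Filtration ℕ mΩ}

/-- Martingale differences are orthogonal in `L²`. -/
theorem integral_sq_sum_martingaleDiff {η : ℕ → Ω → ℝ}
    (hmeas : ∀ k, StronglyMeasurable[ℱ (k + 1)] (η k)) (hL2 : ∀ k, MemLp (η k) 2 P)
    (hce : ∀ k, P[η k | ℱ k] =ᵐ[P] 0) (n : ℕ) :
    ∫ ω, (∑ k ∈ Finset.range n, η k ω) ^ 2 ∂P = ∑ k ∈ Finset.range n, ∫ ω, η k ω ^ 2 ∂P := by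
  induction n with
  | zero => simp
  | succ n ih =>
    have hS : MemLp (fun ω => ∑ k ∈ Finset.range n, η k ω) 2 P :=
      memLp_finsetSum _ fun k _ => hL2 k
    have hSm : StronglyMeasurable[ℱ n] (fun ω => ∑ k ∈ Finset.range n, η k ω) :=
      Finset.stronglyMeasurable_fun_sum _ fun k hk =>
        (hmeas k).mono (ℱ.mono (Finset.mem_range.1 hk))
    have hmul : Integrable (fun ω => (∑ k ∈ Finset.range n, η k ω) * η n ω) P :=
      hS.integrable_mul (hL2 n)
    have hcross : ∫ ω, (∑ k ∈ Finset.range n, η k ω) * η n ω ∂P = 0 := by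
      rw [← integral_condExp (ℱ.le n)]
      have h1 := condExp_mul_of_stronglyMeasurable_left hSm hmul
        ((hL2 n).integrable (by norm_num))
      have h2 : P[fun ω => (∑ k ∈ Finset.range n, η k ω) * η n ω | ℱ n] =ᵐ[P] 0 := by
        filter_upwards [h1, hce n] with ω h1 h2
        exact h1.trans (by simp [h2])
      rw [integral_congr_ae h2]
      simp
    have hexp : ∀ ω, (∑ k ∈ Finset.range (n + 1), η k ω) ^ 2 =
        (∑ k ∈ Finset.range n, η k ω) ^ 2 + 2 * ((∑ k ∈ Finset.range n, η k ω) * η n ω)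
          + η n ω ^ 2 := fun ω => by
      rw [Finset.sum_range_succ]; ring
    have hmul2 := hmul.const_mul 2
    have h1 := integral_add (hS.integrable_sq.add hmul2) (hL2 n).integrable_sq
    have h2 := integral_add hS.integrable_sq hmul2
    simp only [Pi.add_apply] at h1
    simp_rw [hexp]
    rw [h1, h2, integral_const_mul, hcross, ih, Finset.sum_range_succ]
    simp

/-- An `L²`-bounded series of martingale differences converges almost surely. -/
theorem exists_tendsto_sum_martingaleDiff {η : ℕ → Ω → ℝ}
    (hmeas : ∀ k, StronglyMeasurable[ℱ (k + 1)] (η k)) (hL2 : ∀ k, MemLp (η k) 2 P)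
    (hce : ∀ k, P[η k | ℱ k] =ᵐ[P] 0) {R : ℝ}
    (hR : ∀ n, ∑ k ∈ Finset.range n, ∫ ω, η k ω ^ 2 ∂P ≤ R) :
    ∀ᵐ ω ∂P, ∃ c, Tendsto (fun n => ∑ k ∈ Finset.range n, η k ω) atTop (𝓝 c) := by
  set S : ℕ → Ω → ℝ := fun n ω => ∑ k ∈ Finset.range n, η k ω with hSdef
  have hS : ∀ n, MemLp (S n) 2 P := fun n => memLp_finsetSum _ fun k _ => hL2 k
  have hSi : ∀ n, Integrable (S n) P := fun n => (hS n).integrable (by norm_num)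
  have hmart : Martingale S ℱ P := by
    refine martingale_of_condExp_sub_eq_zero_nat (fun n => ?_) hSi fun n => ?_
    · exact Finset.stronglyMeasurable_fun_sum _ fun k hk =>
        (hmeas k).mono (ℱ.mono (Finset.mem_range.1 hk))
    · have : S (n + 1) - S n = η n := by
        ext ω
        simp [hSdef, Finset.sum_range_succ]
      rw [this]
      exact hce n
  refine hmart.submartingale.exists_ae_tendsto_of_bdd (R := Real.toNNReal (1 + R)) fun n => ?_
  -- The `L¹` norm is controlled by the second moment through `|t| ≤ 1 + t ^ 2`.
  rw [eLpNorm_one_eq_lintegral_enorm, ← ofReal_integral_norm_eq_lintegral_enorm (hSi n)]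
  refine ENNReal.ofReal_le_ofReal ?_
  calc ∫ ω, ‖S n ω‖ ∂P ≤ ∫ ω, (1 + S n ω ^ 2) ∂P := by
        refine integral_mono (hSi n).norm ((integrable_const 1).add (hS n).integrable_sq)
          fun ω => ?_
        change ‖S n ω‖ ≤ 1 + S n ω ^ 2
        rw [Real.norm_eq_abs, ← sq_abs]
        nlinarith [sq_nonneg (|S n ω| - 1), abs_nonneg (S n ω)]
    _ = 1 + ∫ ω, S n ω ^ 2 ∂P := by
        rw [integral_add (integrable_const 1) (hS n).integrable_sq]
        simp
    _ ≤ 1 + R := by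
        have := integral_sq_sum_martingaleDiff hmeas hL2 hce n
        have := hR n
        simp only [hSdef]
        linarith

/-- Strong law under uniformly bounded second moments: dividing the `k`-th difference by `k + 1`
makes the second moments summable. -/
theorem tendsto_average_martingaleDiff_of_integral_sq_le {ξ : ℕ → Ω → ℝ}
    (hmeas : ∀ k, StronglyMeasurable[ℱ (k + 1)] (ξ k)) (hL2 : ∀ k, MemLp (ξ k) 2 P)
    (hce : ∀ k, P[ξ k | ℱ k] =ᵐ[P] 0) {M : ℝ} (hM : ∀ k, ∫ ω, ξ k ω ^ 2 ∂P ≤ M) :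
    ∀ᵐ ω ∂P, Tendsto (fun n : ℕ => (∑ k ∈ Finset.range n, ξ k ω) / n) atTop (𝓝 0) := by
  have hsum : Summable fun k : ℕ => M * (1 / ((k : ℝ) + 1) ^ 2) := by
    have h := (summable_nat_add_iff 1).2 (Real.summable_one_div_nat_pow.2 one_lt_two)
    exact (by simpa using h : Summable fun k : ℕ => 1 / ((k : ℝ) + 1) ^ 2).mul_left M
  have hM0 : 0 ≤ M := (integral_nonneg fun ω => sq_nonneg _).trans (hM 0)
  have h := exists_tendsto_sum_martingaleDiff (P := P) (ℱ := ℱ)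
    (η := fun k ω => ξ k ω / ((k : ℝ) + 1))
    (R := ∑' k : ℕ, M * (1 / ((k : ℝ) + 1) ^ 2))
    (fun k => by
      simp_rw [div_eq_mul_inv]
      exact (hmeas k).mul_const _)
    (fun k => by
      simp_rw [div_eq_mul_inv]
      exact (hL2 k).mul_const _)
    (fun k => by
      have h1 := condExp_smul ((k : ℝ) + 1)⁻¹ (ξ k) (ℱ k) (μ := P)
      have h2 : (((k : ℝ) + 1)⁻¹ • ξ k) = fun ω => ξ k ω / ((k : ℝ) + 1) := by
        ext ω
        simp [div_eq_inv_mul]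
      rw [h2] at h1
      filter_upwards [h1, hce k] with ω h1 h2
      rw [h1]
      simp [h2])
    (fun n => by
      refine le_trans (Finset.sum_le_sum fun k _ => ?_)
        (hsum.sum_le_tsum _ fun k _ => by positivity)
      simp_rw [div_pow, div_eq_mul_inv]
      rw [integral_mul_const, one_mul]
      exact mul_le_mul_of_nonneg_right (hM k) (by positivity))
  filter_upwards [h] with ω ⟨c, hc⟩
  exact tendsto_sum_div_of_tendsto_sum_div_succ hc

/-- Strong law of large numbers for square integrable martingale differences whose conditional
variances are almost surely bounded, by a bound that may depend on the outcome. Truncation on the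
predictable events where the conditional variance is at most `M` reduces to bounded variances. -/
theorem tendsto_average_martingaleDiff {ξ : ℕ → Ω → ℝ}
    (hmeas : ∀ k, StronglyMeasurable[ℱ (k + 1)] (ξ k)) (hL2 : ∀ k, MemLp (ξ k) 2 P)
    (hce : ∀ k, P[ξ k | ℱ k] =ᵐ[P] 0)
    (hbdd : ∀ᵐ ω ∂P, BddAbove (Set.range fun k : ℕ => (P[fun ω' => ξ k ω' ^ 2 | ℱ k]) ω)) :
    ∀ᵐ ω ∂P, Tendsto (fun n : ℕ => (∑ k ∈ Finset.range n, ξ k ω) / n) atTop (𝓝 0) := by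
  set A : ℕ → ℕ → Set Ω := fun M k => {ω | (P[fun ω' => ξ k ω' ^ 2 | ℱ k]) ω ≤ M} with hA
  have hAm : ∀ M k, MeasurableSet[ℱ k] (A M k) := fun M k =>
    @measurableSet_le _ _ _ _ _ (ℱ k) _ _ _ _ _ stronglyMeasurable_condExp.measurable
      measurable_const
  have hmain : ∀ M : ℕ, ∀ᵐ ω ∂P, Tendsto
      (fun n : ℕ => (∑ k ∈ Finset.range n, (A M k).indicator (ξ k) ω) / n) atTop (𝓝 0) := by
    intro M
    refine tendsto_average_martingaleDiff_of_integral_sq_le (ℱ := ℱ) (M := M)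
      (fun k => (hmeas k).indicator (ℱ.mono (Nat.le_succ k) _ (hAm M k)))
      (fun k => (hL2 k).indicator (ℱ.le k _ (hAm M k))) (fun k => ?_) (fun k => ?_)
    · filter_upwards [condExp_indicator ((hL2 k).integrable (by norm_num)) (hAm M k), hce k]
        with ω h1 h2
      rw [h1]
      by_cases hω : ω ∈ A M k <;> simp [hω, h2]
    · have h1 : ∀ ω, (A M k).indicator (ξ k) ω ^ 2
          = (A M k).indicator (fun ω => ξ k ω ^ 2) ω := fun ω => by
        by_cases hω : ω ∈ A M k <;> simp [hω]
      simp_rw [h1]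
      rw [integral_indicator (ℱ.le k _ (hAm M k)),
        ← setIntegral_condExp (ℱ.le k) (hL2 k).integrable_sq (hAm M k)]
      calc _ ≤ ∫ ω in A M k, (M : ℝ) ∂P :=
            setIntegral_mono_on integrable_condExp.integrableOn (integrable_const _)
              (ℱ.le k _ (hAm M k)) fun ω hω => hω
        _ ≤ M := by
            rw [setIntegral_const, smul_eq_mul]
            exact mul_le_of_le_one_left (Nat.cast_nonneg M) measureReal_le_one
  filter_upwards [ae_all_iff.2 hmain, hbdd] with ω h1 ⟨B, hB⟩
  obtain ⟨M, hM⟩ := exists_nat_ge B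
  have hmem : ∀ k, ω ∈ A M k := fun k => (hB ⟨k, rfl⟩).trans hM
  refine (h1 M).congr fun n => ?_
  simp only [Set.indicator_of_mem (hmem _)]

end MartingaleDifferences

/-! ### Identifiability on locally D-optimal batches -/

section Design

variable {𝒳 Θ : Type*} {p : ℕ}

theorem exists_saturatedCriterion_pos {f : Θ → 𝒳 → EuclideanSpace ℝ (Fin p)} {θ : Θ}
    (h : Submodule.span ℝ (Set.range (f θ)) = ⊤) : ∃ z, 0 < saturatedCriterion f θ z := by
  obtain ⟨b, hb, -, hli⟩ := Submodule.exists_fun_fin_finrank_span_eq ℝ (Set.range (f θ))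
  have hrank : Module.finrank ℝ (Submodule.span ℝ (Set.range (f θ))) = p := by
    rw [h, finrank_top, finrank_euclideanSpace_fin]
  choose z hz using hb
  have hli' : LinearIndependent ℝ
      (Matrix.of (fun i j : Fin p => f θ (z (Fin.cast hrank.symm j)) i)).col := by
    have h1 := (hli.comp _ (Fin.cast_injective hrank.symm)).map'
      (WithLp.linearEquiv 2 ℝ (Fin p → ℝ)).toLinearMap (LinearEquiv.ker _)
    have h2 : (Matrix.of (fun i j : Fin p => f θ (z (Fin.cast hrank.symm j)) i)).col =
        (WithLp.linearEquiv 2 ℝ (Fin p → ℝ)).toLinearMap ∘ b ∘ Fin.cast hrank.symm := by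
      ext j i
      simp [Matrix.col, hz]
    rw [h2]
    exact h1
  rw [Matrix.linearIndependent_cols_iff_isUnit, Matrix.isUnit_iff_isUnit_det] at hli'
  exact ⟨fun j => z (Fin.cast hrank.symm j), sq_pos_of_ne_zero hli'.ne_zero⟩

/-- A parameter is determined by its mean responses at the points of any nonsingular saturated
design. Both (SI) and (GLM*) give this property, and the consistency proof uses them only through
it. -/
def IdentifiableOnNonsingular (μ : 𝒳 → Θ → ℝ) (f : Θ → 𝒳 → EuclideanSpace ℝ (Fin p)) : Prop :=
  ∀ (θ : Θ) (z : Fin p → 𝒳), 0 < saturatedCriterion f θ z →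
    Function.Injective fun (θ' : Θ) (j : Fin p) => μ (z j) θ'

theorem SI.identifiableOnNonsingular {μ : 𝒳 → Θ → ℝ} (h : SI p μ)
    (f : Θ → 𝒳 → EuclideanSpace ℝ (Fin p)) : IdentifiableOnNonsingular μ f := by
  refine fun θ z hz => h z fun i j hij => ?_
  by_contra hne
  have h0 : (Matrix.of (fun i j : Fin p => f θ (z j) i)).det = 0 :=
    Matrix.det_zero_of_column_eq hne fun k => by simp [hij]
  simp [saturatedCriterion, h0] at hz

theorem GLMStar.identifiableOnNonsingular [TopologicalSpace 𝒳] [TopologicalSpace Θ]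
    {μ : 𝒳 → Θ → ℝ} {f : Θ → 𝒳 → EuclideanSpace ℝ (Fin p)} (h : GLMStar μ f) :
    IdentifiableOnNonsingular μ f := by
  obtain ⟨ψ, f₀, ι, I, G, hglm, hι, hIo, hIc, hG, hG', hmem, hμ⟩ := h
  intro θ z hz θ₁ θ₂ h12
  have hmono : StrictMonoOn G I := strictMonoOn_of_deriv_pos hIc.convex hG.continuousOn
    (by rwa [hIo.interior_eq])
  have hinner : ∀ j, inner ℝ (f₀ (z j)) (ι θ₁) = inner ℝ (f₀ (z j)) (ι θ₂) := fun j => by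
    have := congrFun h12 j
    simp only [hμ] at this
    exact hmono.injOn (hmem _ _) (hmem _ _) this
  refine hι.injective (sub_eq_zero.1 ?_)
  have hdet : (Matrix.of (fun i j : Fin p => f θ (z j) i)).det ≠ 0 := by
    rintro h0
    simp [saturatedCriterion, h0] at hz
  have hv : Matrix.vecMul (WithLp.ofLp (ι θ₁ - ι θ₂))
      (Matrix.of (fun i j : Fin p => f θ (z j) i)) = 0 := by
    ext j
    have h1 : inner ℝ (f θ (z j)) (ι θ₁ - ι θ₂) = 0 := by
      rw [hglm.family_eq, inner_smul_left, inner_sub_right, hinner j, sub_self, mul_zero]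
    rw [PiLp.inner_apply] at h1
    simpa [Matrix.vecMul, dotProduct] using h1
  have h0 := Matrix.eq_zero_of_vecMul_eq_zero hdet hv
  ext i
  exact congrFun h0 i

variable [MetricSpace 𝒳] [CompactSpace 𝒳] [MetricSpace Θ] [CompactSpace Θ]

/-- Uniform separation: over all locally D-optimal batches and all parameters at distance at
least `ε` from `θbar`, the squared differences of mean responses have a positive lower bound.
The pairs of a parameter and a design that is optimal for it form a closed, hence compact, set. -/
theorem exists_pos_le_sum_sq_sub {μ : 𝒳 → Θ → ℝ} {f : Θ → 𝒳 → EuclideanSpace ℝ (Fin p)}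
    (hbasic : BasicConditions μ f) (hid : IdentifiableOnNonsingular μ f) (θbar : Θ) {ε : ℝ}
    (hε : 0 < ε) :
    ∃ c, 0 < c ∧ ∀ (θ : Θ) (z : Fin p → 𝒳),
      (∀ w, saturatedCriterion f θ w ≤ saturatedCriterion f θ z) →
      ∀ θ', ε ≤ dist θ' θbar → c ≤ ∑ j, (μ (z j) θ' - μ (z j) θbar) ^ 2 := by
  have hcrit : Continuous fun q : Θ × (Fin p → 𝒳) => saturatedCriterion f q.1 q.2 := by
    unfold saturatedCriterion
    refine (Continuous.matrix_det (continuous_matrix fun i j => ?_)).pow 2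
    have h : Continuous fun q : Θ × (Fin p → 𝒳) => f q.1 (q.2 j) :=
      hbasic.continuous_family.comp (f := fun q : Θ × (Fin p → 𝒳) => (q.2 j, q.1))
        (((continuous_apply j).comp continuous_snd).prodMk continuous_fst)
    exact (EuclideanSpace.proj (𝕜 := ℝ) i).continuous.comp h
  set K : Set ((Θ × (Fin p → 𝒳)) × Θ) := (⋂ w, {q | saturatedCriterion f q.1.1 w ≤
    saturatedCriterion f q.1.1 q.1.2}) ∩ {q | ε ≤ dist q.2 θbar}
  have hKc : IsCompact K := by
    refine IsClosed.isCompact (IsClosed.inter ?_ ?_)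
    · refine isClosed_iInter fun w => isClosed_le ?_ (hcrit.comp continuous_fst)
      exact hcrit.comp (f := fun q : (Θ × (Fin p → 𝒳)) × Θ => (q.1.1, w))
        ((continuous_fst.comp continuous_fst).prodMk continuous_const)
    · exact isClosed_le continuous_const (continuous_snd.dist continuous_const)
  have hcont : Continuous fun q : (Θ × (Fin p → 𝒳)) × Θ =>
      ∑ j, (μ (q.1.2 j) q.2 - μ (q.1.2 j) θbar) ^ 2 := by
    have hz : ∀ j, Continuous fun q : (Θ × (Fin p → 𝒳)) × Θ => q.1.2 j := fun j =>
      (continuous_apply j).comp (continuous_snd.comp continuous_fst)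
    exact continuous_finsetSum _ fun j _ => (((hbasic.continuous_mean.comp
      ((hz j).prodMk continuous_snd)).sub (hbasic.continuous_mean.comp
      ((hz j).prodMk continuous_const))).pow 2)
  obtain ⟨c, hc, hle⟩ := hKc.exists_forall_le' (a := 0) hcont.continuousOn (by
    rintro ⟨⟨θ, z⟩, θ'⟩ ⟨hmax, hdist⟩
    replace hmax : ∀ w, saturatedCriterion f θ w ≤ saturatedCriterion f θ z := fun w =>
      Set.mem_iInter.1 hmax w
    replace hdist : ε ≤ dist θ' θbar := hdist
    obtain ⟨w, hw⟩ := exists_saturatedCriterion_pos (hbasic.span_eq_top θ)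
    have hinj := hid θ z (hw.trans_le (hmax w))
    refine lt_of_le_of_ne (Finset.sum_nonneg fun j _ => sq_nonneg _) fun h0 => ?_
    rw [eq_comm, Finset.sum_eq_zero_iff_of_nonneg fun j _ => sq_nonneg _] at h0
    have heq : θ' = θbar := hinj <| funext fun j => by
      simpa [sub_eq_zero] using h0 j (Finset.mem_univ j)
    rw [heq, dist_self] at hdist
    exact hε.not_ge hdist)
  exact ⟨c, hc, fun θ z hmax θ' hd => hle ((θ, z), θ') ⟨Set.mem_iInter.2 hmax, hd⟩⟩

end Design

/-! ### Laws of large numbers in the adaptive regression model -/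

theorem sampleSize_le_succ (n₁ p k : ℕ) : sampleSize n₁ p k ≤ sampleSize n₁ p (k + 1) := by
  cases k with
  | zero => exact Nat.zero_le _
  | succ k => exact Nat.add_le_add_left (Nat.mul_le_mul_right _ (Nat.le_succ k)) _

theorem card_batch_le (n₁ p k : ℕ) :
    (Finset.Ico (sampleSize n₁ p k) (sampleSize n₁ p (k + 1))).card ≤ n₁ + p := by
  rw [Nat.card_Ico]
  cases k with
  | zero => simp [sampleSize]
  | succ k =>
    have h : sampleSize n₁ p (k + 2) = sampleSize n₁ p (k + 1) + p := by
      simp [sampleSize, add_mul, add_assoc]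
    rw [h]
    omega

theorem sum_range_sampleSize (n₁ p : ℕ) (a : ℕ → ℝ) (k : ℕ) :
    ∑ i ∈ Finset.range (sampleSize n₁ p k), a i =
      ∑ j ∈ Finset.range k, ∑ i ∈ Finset.Ico (sampleSize n₁ p j) (sampleSize n₁ p (j + 1)),
        a i := by
  induction k with
  | zero => simp [sampleSize]
  | succ k ih => rw [Finset.sum_range_succ, ← ih,
      Finset.sum_range_add_sum_Ico _ (sampleSize_le_succ n₁ p k)]

/-- Cauchy–Schwarz over a batch; batches have at most `n₁ + p` elements, so that the constant does
not depend on `k`. -/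
theorem sq_sum_batch_mul_le (n₁ p k : ℕ) {w a : ℕ → ℝ} {C : ℝ} (hw : ∀ i, |w i| ≤ C) :
    (∑ i ∈ Finset.Ico (sampleSize n₁ p k) (sampleSize n₁ p (k + 1)), w i * a i) ^ 2 ≤
      ((n₁ + p : ℕ) : ℝ) * C ^ 2 *
        ∑ i ∈ Finset.Ico (sampleSize n₁ p k) (sampleSize n₁ p (k + 1)), a i ^ 2 := by
  refine (sq_sum_le_card_mul_sum_sq).trans ?_
  rw [mul_assoc, Finset.mul_sum _ _ (C ^ 2)]
  refine mul_le_mul (by exact_mod_cast card_batch_le n₁ p k) (Finset.sum_le_sum fun i _ => ?_)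
    (Finset.sum_nonneg fun i _ => sq_nonneg _) (Nat.cast_nonneg _)
  rw [mul_pow]
  exact mul_le_mul_of_nonneg_right (sq_le_sq' (neg_le_of_abs_le (hw i)) (le_of_abs_le (hw i)))
    (sq_nonneg _)

section Model

variable {Ω 𝒳 Θ : Type*} {mΩ : MeasurableSpace Ω} [MeasurableSpace 𝒳]
  {P : Measure Ω} {n₁ p : ℕ} {μ : 𝒳 → Θ → ℝ} {θbar : Θ}
  {ℱ : Filtration ℕ mΩ} {X : ℕ → Ω → 𝒳} {Y e : ℕ → Ω → ℝ}

theorem AdaptiveRegressionModel.stronglyMeasurable_error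
    (h : AdaptiveRegressionModel P n₁ p μ θbar ℱ X Y e) (hμ : Measurable fun x => μ x θbar)
    {k i : ℕ} (h1 : sampleSize n₁ p k ≤ i) (h2 : i < sampleSize n₁ p (k + 1)) :
    StronglyMeasurable[ℱ (k + 1)] (e i) := by
  have he : e i = fun ω => Y i ω - μ (X i ω) θbar := by
    ext ω
    rw [h.response_eq]
    ring
  rw [he]
  refine Measurable.stronglyMeasurable ?_
  exact (h.measurable_Y k i h1 h2).sub
    (hμ.comp ((h.measurable_X k i h1 h2).mono (ℱ.mono (Nat.le_succ k)) le_rfl))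

theorem AdaptiveRegressionModel.integrable_sum_sq
    (h : AdaptiveRegressionModel P n₁ p μ θbar ℱ X Y e) (k : ℕ) :
    Integrable (fun ω => ∑ i ∈ Finset.Ico (sampleSize n₁ p k) (sampleSize n₁ p (k + 1)),
      e i ω ^ 2) P :=
  integrable_finsetSum _ fun i _ => (h.memLp_error i).integrable_sq

variable [IsProbabilityMeasure P]

/-- The errors, weighted by a bounded function of the design points, average out. -/
theorem AdaptiveRegressionModel.tendsto_average_mul_error
    (h : AdaptiveRegressionModel P n₁ p μ θbar ℱ X Y e) (hμ : Measurable fun x => μ x θbar)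
    {φ : 𝒳 → ℝ} (hφ : Measurable φ) {C : ℝ} (hC : ∀ x, |φ x| ≤ C) :
    ∀ᵐ ω ∂P, Tendsto (fun k : ℕ =>
      (∑ i ∈ Finset.range (sampleSize n₁ p k), φ (X i ω) * e i ω) / k) atTop (𝓝 0) := by
  simp_rw [sum_range_sampleSize]
  have hX : ∀ k i, sampleSize n₁ p k ≤ i → i < sampleSize n₁ p (k + 1) →
      StronglyMeasurable[ℱ k] fun ω => φ (X i ω) := fun k i h1 h2 =>
    Measurable.stronglyMeasurable (hφ.comp (h.measurable_X k i h1 h2))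
  have hterm : ∀ k i, sampleSize n₁ p k ≤ i → i < sampleSize n₁ p (k + 1) →
      MemLp (fun ω => φ (X i ω) * e i ω) 2 P := fun k i h1 h2 =>
    (h.memLp_error i).of_le_mul (c := C)
      (((hX k i h1 h2).mono (ℱ.le k)).aestronglyMeasurable.mul (h.memLp_error i).1)
      (ae_of_all _ fun ω => by
        rw [norm_mul]
        exact mul_le_mul_of_nonneg_right (hC _) (norm_nonneg _))
  have hL2 : ∀ k, MemLp (fun ω => ∑ i ∈ Finset.Ico (sampleSize n₁ p k)
      (sampleSize n₁ p (k + 1)), φ (X i ω) * e i ω) 2 P := fun k =>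
    memLp_finsetSum _ fun i hi => hterm k i (Finset.mem_Ico.1 hi).1 (Finset.mem_Ico.1 hi).2
  refine tendsto_average_martingaleDiff (ℱ := ℱ) (fun k => ?_) hL2 (fun k => ?_) ?_
  · refine Finset.stronglyMeasurable_fun_sum _ fun i hi => ?_
    obtain ⟨h1, h2⟩ := Finset.mem_Ico.1 hi
    exact ((hX k i h1 h2).mono (ℱ.mono (Nat.le_succ k))).mul
      (h.stronglyMeasurable_error hμ h1 h2)
  · have hs := condExp_finsetSum (μ := P) (f := fun i ω => φ (X i ω) * e i ω)
      (s := Finset.Ico (sampleSize n₁ p k) (sampleSize n₁ p (k + 1)))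
      (fun i hi => (hterm k i (Finset.mem_Ico.1 hi).1 (Finset.mem_Ico.1 hi).2).integrable
        (by norm_num)) (ℱ k)
    have hz : ∀ᵐ ω ∂P, ∀ i ∈ Finset.Ico (sampleSize n₁ p k) (sampleSize n₁ p (k + 1)),
        (P[fun ω => φ (X i ω) * e i ω | ℱ k]) ω = 0 := by
      refine (Finset.eventually_all _).2 fun i hi => ?_
      obtain ⟨h1, h2⟩ := Finset.mem_Ico.1 hi
      filter_upwards [condExp_mul_of_stronglyMeasurable_left (hX k i h1 h2)
        ((hterm k i h1 h2).integrable (by norm_num))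
        ((h.memLp_error i).integrable (by norm_num)), h.condExp_error k i h1 h2] with ω h3 h4
      exact h3.trans (by simp [h4])
    have hfun : (∑ i ∈ Finset.Ico (sampleSize n₁ p k) (sampleSize n₁ p (k + 1)),
        fun ω => φ (X i ω) * e i ω) = fun ω => ∑ i ∈ Finset.Ico (sampleSize n₁ p k)
          (sampleSize n₁ p (k + 1)), φ (X i ω) * e i ω := by
      ext ω
      simp
    rw [hfun] at hs
    filter_upwards [hs, hz] with ω h1 h2
    rw [h1, Finset.sum_apply]
    exact Finset.sum_eq_zero h2
  · have hle : ∀ᵐ ω ∂P, ∀ k, (P[fun ω' => (∑ i ∈ Finset.Ico (sampleSize n₁ p k)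
        (sampleSize n₁ p (k + 1)), φ (X i ω') * e i ω') ^ 2 | ℱ k]) ω ≤
        ((n₁ + p : ℕ) : ℝ) * C ^ 2 * (P[fun ω' => ∑ i ∈ Finset.Ico (sampleSize n₁ p k)
        (sampleSize n₁ p (k + 1)), e i ω' ^ 2 | ℱ k]) ω := by
      refine ae_all_iff.2 fun k => ?_
      have hi := h.integrable_sum_sq k
      filter_upwards [condExp_mono (m := ℱ k) (hL2 k).integrable_sq
        (hi.const_mul (((n₁ + p : ℕ) : ℝ) * C ^ 2))
        (ae_of_all _ fun ω => sq_sum_batch_mul_le n₁ p k fun i => hC (X i ω)),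
        condExp_smul (((n₁ + p : ℕ) : ℝ) * C ^ 2) (fun ω' => ∑ i ∈ Finset.Ico
          (sampleSize n₁ p k) (sampleSize n₁ p (k + 1)), e i ω' ^ 2) (ℱ k) (μ := P)]
        with ω h1 h2
      exact h1.trans h2.le
    filter_upwards [hle, h.bddAbove_condExp_sq] with ω h1 ⟨B, hB⟩
    refine ⟨((n₁ + p : ℕ) : ℝ) * C ^ 2 * B, ?_⟩
    rintro _ ⟨k, rfl⟩
    exact (h1 k).trans (mul_le_mul_of_nonneg_left (hB ⟨k, rfl⟩) (by positivity))

/-- The sums of absolute errors grow at most linearly in the number of batches. The centered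
absolute batch errors obey the strong law, and their conditional means are bounded by means of
`|t| ≤ 1 + t ^ 2`. -/
theorem AdaptiveRegressionModel.exists_sum_abs_error_le
    (h : AdaptiveRegressionModel P n₁ p μ θbar ℱ X Y e) (hμ : Measurable fun x => μ x θbar) :
    ∀ᵐ ω ∂P, ∃ B : ℝ, ∀ k : ℕ,
      ∑ i ∈ Finset.range (sampleSize n₁ p k), |e i ω| ≤ B * k := by
  simp_rw [sum_range_sampleSize]
  set A : ℕ → Ω → ℝ := fun k ω =>
    ∑ i ∈ Finset.Ico (sampleSize n₁ p k) (sampleSize n₁ p (k + 1)), |e i ω| with hA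
  set W : ℕ → Ω → ℝ := fun k ω =>
    ∑ i ∈ Finset.Ico (sampleSize n₁ p k) (sampleSize n₁ p (k + 1)), e i ω ^ 2 with hW
  have hWi : ∀ k, Integrable (W k) P := h.integrable_sum_sq
  have hAL2 : ∀ k, MemLp (A k) 2 P := fun k =>
    memLp_finsetSum _ fun i _ => (h.memLp_error i).abs
  have hAi : ∀ k, Integrable (A k) P := fun k => (hAL2 k).integrable (by norm_num)
  have hAm : ∀ k, StronglyMeasurable[ℱ (k + 1)] (A k) := fun k =>
    Finset.stronglyMeasurable_fun_sum _ fun i hi => by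
      obtain ⟨h1, h2⟩ := Finset.mem_Ico.1 hi
      exact (h.stronglyMeasurable_error hμ h1 h2).norm
  have hsq : ∀ k ω, A k ω ^ 2 ≤ ((n₁ + p : ℕ) : ℝ) * W k ω := fun k ω => by
    have := sq_sum_batch_mul_le n₁ p k (w := fun _ => 1) (a := fun i => |e i ω|) (C := 1)
      (by simp)
    simpa [hA, hW] using this
  have hcond : ∀ᵐ ω ∂P, ∀ k, (P[fun ω' => A k ω' ^ 2 | ℱ k]) ω ≤
      ((n₁ + p : ℕ) : ℝ) * (P[W k | ℱ k]) ω := by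
    refine ae_all_iff.2 fun k => ?_
    filter_upwards [condExp_mono (m := ℱ k) (hAL2 k).integrable_sq
      ((hWi k).const_mul ((n₁ + p : ℕ) : ℝ)) (ae_of_all _ (hsq k)),
      condExp_smul ((n₁ + p : ℕ) : ℝ) (W k) (ℱ k) (μ := P)] with ω h1 h2
    exact h1.trans h2.le
  have hmean : ∀ᵐ ω ∂P, ∀ k, (P[A k | ℱ k]) ω ≤ ((n₁ + p : ℕ) : ℝ) + (P[W k | ℱ k]) ω := by
    refine ae_all_iff.2 fun k => ?_
    have hle : ∀ ω, A k ω ≤ ((n₁ + p : ℕ) : ℝ) + W k ω := fun ω => by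
      have h1 : A k ω ≤ ∑ i ∈ Finset.Ico (sampleSize n₁ p k) (sampleSize n₁ p (k + 1)),
          (1 + e i ω ^ 2) := Finset.sum_le_sum fun i _ => by
        rw [← sq_abs]
        nlinarith [sq_nonneg (|e i ω| - 1), abs_nonneg (e i ω)]
      have h2 : (((Finset.Ico (sampleSize n₁ p k) (sampleSize n₁ p (k + 1))).card : ℕ) : ℝ)
          ≤ ((n₁ + p : ℕ) : ℝ) := by exact_mod_cast card_batch_le n₁ p k
      rw [Finset.sum_add_distrib, Finset.sum_const, nsmul_eq_mul, mul_one] at h1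
      linarith
    filter_upwards [condExp_mono (m := ℱ k) (hAi k)
      ((integrable_const ((n₁ + p : ℕ) : ℝ)).add (hWi k)) (ae_of_all _ hle),
      condExp_add (integrable_const ((n₁ + p : ℕ) : ℝ)) (hWi k) (ℱ k) (μ := P)] with ω h1 h2
    rw [condExp_const (ℱ.le k)] at h2
    exact h1.trans h2.le
  have hslln := tendsto_average_martingaleDiff (P := P) (ℱ := ℱ)
    (ξ := fun k => A k - P[A k | ℱ k])
    (fun k => (hAm k).sub (stronglyMeasurable_condExp.mono (ℱ.mono (Nat.le_succ k))))
    (fun k => (hAL2 k).sub ((hAL2 k).condExp one_le_two))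
    (fun k => by
      have h1 := condExp_sub (hAi k) (integrable_condExp (μ := P) (m := ℱ k) (f := A k)) (ℱ k)
      rw [condExp_of_stronglyMeasurable (ℱ.le k) stronglyMeasurable_condExp
        integrable_condExp] at h1
      filter_upwards [h1] with ω h1
      rw [h1]
      simp)
    (by
      have hvar : ∀ᵐ ω ∂P, ∀ k, Var[A k; P | ℱ k] ω ≤ (P[A k ^ 2 | ℱ k]) ω :=
        ae_all_iff.2 fun k => condVar_ae_le_condExp_sq (ℱ.le k) (hAL2 k)
      filter_upwards [hvar, hcond, h.bddAbove_condExp_sq] with ω h1 h2 ⟨B, hB⟩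
      refine ⟨((n₁ + p : ℕ) : ℝ) * B, ?_⟩
      rintro _ ⟨k, rfl⟩
      exact (h1 k).trans ((h2 k).trans
        (mul_le_mul_of_nonneg_left (hB ⟨k, rfl⟩) (Nat.cast_nonneg _))))
  filter_upwards [hslln, hmean, h.bddAbove_condExp_sq] with ω h1 h2 ⟨B, hB⟩
  obtain ⟨D, hD⟩ := h1.bddAbove_range
  refine ⟨D + ((n₁ + p : ℕ) + B), fun k => ?_⟩
  rcases Nat.eq_zero_or_pos k with rfl | hk
  · simp
  have hk' : (0 : ℝ) < k := by exact_mod_cast hk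
  have h3 := (div_le_iff₀ hk').1 (hD ⟨k, rfl⟩)
  simp only [Pi.sub_apply, Finset.sum_sub_distrib] at h3
  have h4 : ∑ j ∈ Finset.range k, (P[A j | ℱ j]) ω ≤
      ∑ j ∈ Finset.range k, (((n₁ + p : ℕ) : ℝ) + B) :=
    Finset.sum_le_sum fun j _ => (h2 j).trans (by
      have : (P[W j | ℱ j]) ω ≤ B := hB ⟨j, rfl⟩
      linarith)
  rw [Finset.sum_const, Finset.card_range, nsmul_eq_mul] at h4
  linarith

end Model

/-! ### Consistency of least squares along a path -/

/-- The basic inequality of least squares, obtained by comparing the minimizer with `θbar`. -/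
theorem IsLeastSquares.sum_sq_sub_le {𝒳 Θ : Type*} {n₁ p : ℕ} {μ : 𝒳 → Θ → ℝ}
    {est : EstimatorSeq n₁ p 𝒳 Θ} (h : IsLeastSquares μ est) {θbar : Θ} {x : ℕ → 𝒳}
    {y e : ℕ → ℝ} (hy : ∀ i, y i = μ (x i) θbar + e i) (k : ℕ) :
    ∑ i ∈ Finset.range (sampleSize n₁ p k),
        (μ (x i) (est k (dataUpTo n₁ p x y k)) - μ (x i) θbar) ^ 2 ≤
      2 * ∑ i ∈ Finset.range (sampleSize n₁ p k),
        (μ (x i) (est k (dataUpTo n₁ p x y k)) - μ (x i) θbar) * e i := by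
  have h1 := h k (dataUpTo n₁ p x y k) θbar
  set θ := est k (dataUpTo n₁ p x y k)
  simp only [dataUpTo] at h1
  rw [Fin.sum_univ_eq_sum_range (fun i => (y i - μ (x i) θ) ^ 2),
    Fin.sum_univ_eq_sum_range (fun i => (y i - μ (x i) θbar) ^ 2), ← sub_nonneg,
    ← Finset.sum_sub_distrib] at h1
  rw [Finset.mul_sum, ← sub_nonneg, ← Finset.sum_sub_distrib]
  refine h1.trans_eq (Finset.sum_congr rfl fun i _ => ?_)
  rw [hy]
  ring

/-- A lower bound valid on each batch after the first adds up. -/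
theorem mul_le_sum_range_sampleSize {n₁ p : ℕ} {a : ℕ → ℝ} (ha : ∀ i, 0 ≤ a i) {c : ℝ}
    (hc : ∀ k, 1 ≤ k → c ≤ ∑ j : Fin p, a (sampleSize n₁ p k + j)) (k : ℕ) :
    k * c ≤ ∑ i ∈ Finset.range (sampleSize n₁ p (k + 1)), a i := by
  induction k with
  | zero => simpa using Finset.sum_nonneg fun i _ => ha i
  | succ k ih =>
    have h : sampleSize n₁ p (k + 2) = sampleSize n₁ p (k + 1) + p := by
      simp [sampleSize, add_mul, add_assoc]
    have h2 := hc (k + 1) (Nat.le_add_left 1 k)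
    rw [Fin.sum_univ_eq_sum_range (fun j => a (sampleSize n₁ p (k + 1) + j))] at h2
    rw [h, Finset.sum_range_add]
    push_cast
    linarith

section Consistency

variable {𝒳 Θ : Type*} [MetricSpace 𝒳] [CompactSpace 𝒳] [MetricSpace Θ] [CompactSpace Θ]

/-- Consistency for a fixed path. The averages of the errors weighted by
`μ (·, d) - μ (·, θbar)` vanish for countably many `d` with dense range, and uniformly in the
parameter because finitely many `d` approximate every parameter; at the estimate they bound
the average of the squared differences of mean responses, which stays away from `0` unless the
estimate is close to `θbar`. -/
theorem tendsto_leastSquares_of_path {n₁ p : ℕ} {μ : 𝒳 → Θ → ℝ}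
    {f : Θ → 𝒳 → EuclideanSpace ℝ (Fin p)} (hbasic : BasicConditions μ f)
    (hid : IdentifiableOnNonsingular μ f) {θbar : Θ} {est estLS : EstimatorSeq n₁ p 𝒳 Θ}
    (hLS : IsLeastSquares μ estLS) {x : ℕ → 𝒳} {y e : ℕ → ℝ}
    (hy : ∀ i, y i = μ (x i) θbar + e i) (hpath : IsAlgorithmPath n₁ f est x y)
    {d : ℕ → Θ} (hd : DenseRange d)
    (hslln : ∀ m, Tendsto (fun k : ℕ => (∑ i ∈ Finset.range (sampleSize n₁ p k),
      (μ (x i) (d m) - μ (x i) θbar) * e i) / k) atTop (𝓝 0))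
    {B : ℝ} (hB : ∀ k : ℕ, ∑ i ∈ Finset.range (sampleSize n₁ p k), |e i| ≤ B * k) :
    Tendsto (fun k => estLS k (dataUpTo n₁ p x y k)) atTop (𝓝 θbar) := by
  rw [Metric.tendsto_atTop']
  intro ε hε
  obtain ⟨c, hc, hsep⟩ := exists_pos_le_sum_sq_sub hbasic hid θbar hε
  -- With this `η`, twice the weighted error sum at the estimate is eventually at most `c / 2` per
  -- batch, while a far estimate would contribute at least `c` on every batch but the first.
  set η : ℝ := c / (8 * (|B| + 1)) with hη
  have hη0 : 0 < η := by positivity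
  have hηB : η * (|B| + 1) = c / 8 := by rw [hη]; field_simp
  obtain ⟨δ, hδ, huc⟩ := Metric.uniformContinuous_iff.1
    (CompactSpace.uniformContinuous_of_continuous hbasic.continuous_mean) η hη0
  have hosc : ∀ z θ θ', dist θ θ' < δ → |μ z θ - μ z θ'| < η := fun z θ θ' h => by
    have := huc (a := (z, θ)) (b := (z, θ')) (by simpa [Prod.dist_eq, hδ] using h)
    simpa [Real.dist_eq] using this
  obtain ⟨t, ht⟩ := isCompact_univ.elim_finite_subcover (fun m => Metric.ball (d m) δ)
    (fun m => Metric.isOpen_ball) (fun θ _ => by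
      obtain ⟨m, hm⟩ := hd.exists_dist_lt θ hδ
      exact Set.mem_iUnion.2 ⟨m, hm⟩)
  have hev : ∀ᶠ k : ℕ in atTop, ∀ m ∈ t, |(∑ i ∈ Finset.range (sampleSize n₁ p k),
      (μ (x i) (d m) - μ (x i) θbar) * e i) / k| < c / 8 := by
    refine (Finset.eventually_all t).2 fun m _ => ?_
    have := (hslln m).abs
    rw [abs_zero] at this
    exact this.eventually_lt_const (by positivity)
  obtain ⟨N, hN⟩ := eventually_atTop.1 hev
  refine ⟨N + 2, fun k hk => ?_⟩
  by_contra! hfar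
  set θ := estLS k (dataUpTo n₁ p x y k) with hθ
  have hLSk := hLS.sum_sq_sub_le hy k
  rw [← hθ] at hLSk
  obtain ⟨l, rfl⟩ : ∃ l, k = l + 1 := ⟨k - 1, by omega⟩
  have hsignal := mul_le_sum_range_sampleSize (n₁ := n₁) (p := p)
    (a := fun i => (μ (x i) θ - μ (x i) θbar) ^ 2) (fun i => sq_nonneg _)
    (fun j hj => hsep _ _ (hpath j hj) θ hfar) l
  obtain ⟨m, hm, hdist⟩ : ∃ m ∈ t, dist θ (d m) < δ := by
    simpa using ht (Set.mem_univ θ)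
  have hk0 : (0 : ℝ) < (l + 1 : ℕ) := by positivity
  have hnet : ∑ i ∈ Finset.range (sampleSize n₁ p (l + 1)),
      (μ (x i) (d m) - μ (x i) θbar) * e i ≤ c / 8 * (l + 1 : ℕ) :=
    (div_le_iff₀ hk0).1 (le_of_abs_le (hN (l + 1) (by omega) m hm).le)
  have hdiff : ∑ i ∈ Finset.range (sampleSize n₁ p (l + 1)), (μ (x i) θ - μ (x i) (d m)) * e i ≤
      η * (B * (l + 1 : ℕ)) := by
    refine le_trans (Finset.sum_le_sum fun i _ => ?_)
      ((Finset.mul_sum _ _ η).symm.trans_le (mul_le_mul_of_nonneg_left (hB (l + 1)) hη0.le))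
    refine (le_abs_self _).trans ?_
    rw [abs_mul]
    exact mul_le_mul_of_nonneg_right (hosc _ _ _ hdist).le (abs_nonneg _)
  have hsplit : ∑ i ∈ Finset.range (sampleSize n₁ p (l + 1)), (μ (x i) θ - μ (x i) θbar) * e i =
      ∑ i ∈ Finset.range (sampleSize n₁ p (l + 1)), (μ (x i) θ - μ (x i) (d m)) * e i +
      ∑ i ∈ Finset.range (sampleSize n₁ p (l + 1)), (μ (x i) (d m) - μ (x i) θbar) * e i := by
    rw [← Finset.sum_add_distrib]
    exact Finset.sum_congr rfl fun i _ => by ring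
  have hηB' : η * (B * (l + 1 : ℕ)) ≤ c / 8 * (l + 1 : ℕ) := by
    rw [← mul_assoc, ← hηB]
    refine mul_le_mul_of_nonneg_right (mul_le_mul_of_nonneg_left ?_ hη0.le) hk0.le
    linarith [le_abs_self B]
  have hl : (1 : ℝ) < l := by exact_mod_cast (by omega : 1 < l)
  rw [hsplit] at hLSk
  push_cast at hnet hdiff hηB' hsignal
  have hlc := mul_lt_mul_of_pos_right hl hc
  linarith

end Consistency

end PStepAhead

theorem mainTheorem1 {Ω 𝒳 Θ : Type*}
    [MetricSpace 𝒳] [CompactSpace 𝒳] [MeasurableSpace 𝒳] [BorelSpace 𝒳]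
    [MetricSpace Θ] [CompactSpace Θ]
    {mΩ : MeasurableSpace Ω} (P : Measure Ω) [IsProbabilityMeasure P]
    (n₁ p : ℕ) (hn₁ : 1 ≤ n₁) (hp : 1 ≤ p)
    (μ : 𝒳 → Θ → ℝ) (f : Θ → 𝒳 → EuclideanSpace ℝ (Fin p))
    (hbasic : PStepAhead.BasicConditions μ f)
    (θbar : Θ) (ℱ : Filtration ℕ mΩ)
    (X : ℕ → Ω → 𝒳) (Y e : ℕ → Ω → ℝ)
    (hmodel : PStepAhead.AdaptiveRegressionModel P n₁ p μ θbar ℱ X Y e)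
    (est : PStepAhead.EstimatorSeq n₁ p 𝒳 Θ)
    (halg : ∀ᵐ ω ∂P, PStepAhead.IsAlgorithmPath n₁ f est (fun i => X i ω) (fun i => Y i ω))
    (hcond : PStepAhead.SI p μ ∨ PStepAhead.GLMStar μ f)
    (estLS : PStepAhead.EstimatorSeq n₁ p 𝒳 Θ)
    (hLS : PStepAhead.IsLeastSquares μ estLS) :
    ∀ᵐ ω ∂P, Tendsto
      (fun k => estLS k (PStepAhead.dataUpTo n₁ p (fun i => X i ω) (fun i => Y i ω) k))
      atTop (𝓝 θbar) := by
  have hid : PStepAhead.IdentifiableOnNonsingular μ f :=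
    hcond.elim (fun h => h.identifiableOnNonsingular f) fun h => h.identifiableOnNonsingular
  have hcont : ∀ θ, Continuous fun x => μ x θ := fun θ =>
    hbasic.continuous_mean.comp (continuous_id.prodMk continuous_const)
  have : Nonempty Θ := ⟨θbar⟩
  have hslln : ∀ᵐ ω ∂P, ∀ m, Tendsto (fun k : ℕ =>
      (∑ i ∈ Finset.range (PStepAhead.sampleSize n₁ p k),
        (μ (X i ω) (TopologicalSpace.denseSeq Θ m) - μ (X i ω) θbar) * e i ω) / k)
      atTop (𝓝 0) := by
    refine ae_all_iff.2 fun m => ?_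
    have hφ : Continuous fun x => μ x (TopologicalSpace.denseSeq Θ m) - μ x θbar :=
      (hcont _).sub (hcont θbar)
    obtain ⟨C, hC⟩ := isCompact_univ.exists_bound_of_continuousOn hφ.continuousOn
    exact hmodel.tendsto_average_mul_error
      (φ := fun x => μ x (TopologicalSpace.denseSeq Θ m) - μ x θbar) (C := C)
      (hcont θbar).measurable hφ.measurable fun x => hC x (Set.mem_univ x)
  filter_upwards [halg, hslln, hmodel.exists_sum_abs_error_le (hcont θbar).measurable]
    with ω hpath h1 ⟨B, hB⟩
  exact PStepAhead.tendsto_leastSquares_of_path hbasic hid hLS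
    (fun i => hmodel.response_eq i ω) hpath (TopologicalSpace.denseRange_denseSeq Θ) h1 hB
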